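/- For a semigroup $S$ let $\mathrm{rk}(S)\in\mathbb N\cup\{\infty\}$ be the least cardinality of a set generating $S$ as a semigroup, with $\mathrm{rk}(S)=\infty$ if $S$ is not finitely generated (the empty semigroup is allowed and has rank $0$). For a monoid $M$ let $\mathrm{rk}_{\mathcal M}(M)$ be the least cardinality of a nonempty set generating $M$ as a monoid, with $\mathrm{rk}_{\mathcal M}(M)=\infty$ if $M$ is not finitely generated. For an endomorphism $\varphi$ write $\mathrm{Fix}(\varphi)=\{x : \varphi(x)=x\}$. Let $\mathbf{UE}(\mathcal M)$ (respectively $\mathbf{UE}(\mathcal S)$) be the class of all monoids (respectively semigroups) $S$ for which there is $N\in\mathbb N$ such that $\mathrm{rk}(\mathrm{Fix}(\varphi))\le N$ for every monoid (respectively semigroup) endomorphism $\varphi$ of $S$. Theorem. Let $A$ be a finite set and let $a_1,a_2,a_3,a_4\in A$, not necessarily distinct. (1) If $M$ is the monoid defined by the presentation $\langle A\mid a_1a_2=a_3a_4\rangle$, then $\mathrm{rk}_{\mathcal M}(\mathrm{Fix}(\varphi))\le |A|$ for every monoid endomorphism $\varphi$ of $M$. (2) The monoid defined by the presentation $\langle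 A\mid a_1a_2=a_3a_4\rangle$ belongs to $\mathbf{UE}(\mathcal M)$. (3) The semigroup defined by the presentation $\langle A\mid a_1a_2=a_3a_4\rangle$ belongs to $\mathbf{UE}(\mathcal S)$. -/

import Mathlib

/-- The rank `rk S` of a semigroup `S`: the least cardinality of a set generating `S` as a
semigroup, and `⊤` if `S` is not finitely generated. The empty set generates only the empty
semigroup, whose rank is therefore `0`; a generating set of a nonempty semigroup is nonempty. -/
noncomputable def semigroupRank (S : Type*) [Semigroup S] : ℕ∞ :=
  sInf {n : ℕ∞ | ∃ B : Set S, Subsemigroup.closure B = ⊤ ∧ B.encard = n}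

/-- The monoid rank of a monoid `M`: the least cardinality of a nonempty set generating `M` as a
monoid, and `⊤` if `M` is not finitely generated (the trivial monoid has rank `1`). -/
noncomputable def monoidRank (M : Type*) [Monoid M] : ℕ∞ :=
  sInf {n : ℕ∞ | ∃ B : Set M, B.Nonempty ∧ Submonoid.closure B = ⊤ ∧ B.encard = n}

/-- The submonoid of fixed points of a monoid endomorphism. -/
def fixSubmonoid {M : Type*} [Monoid M] (φ : M →* M) : Submonoid M where
  carrier := {x | φ x = x}
  one_mem' := map_one φ
  mul_mem' {x y} hx hy := by
    have hx' : φ x = x := hx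
    have hy' : φ y = y := hy
    show φ (x * y) = x * y
    rw [map_mul, hx', hy']

/-- The (possibly empty) subsemigroup of fixed points of a semigroup endomorphism. -/
def fixSubsemigroup {S : Type*} [Semigroup S] (φ : S →ₙ* S) : Subsemigroup S where
  carrier := {x | φ x = x}
  mul_mem' {x y} hx hy := by
    have hx' : φ x = x := hx
    have hy' : φ y = y := hy
    show φ (x * y) = x * y
    rw [map_mul, hx', hy']

/-- Membership in the class **UE** for the variety of monoids: the semigroup rank of the fixed
point submonoid is uniformly bounded over all monoid endomorphisms. -/
def InUEMonoid (M : Type*) [Monoid M] : Prop :=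
  ∃ N : ℕ, ∀ φ : M →* M, semigroupRank (fixSubmonoid φ) ≤ (N : ℕ∞)

/-- Membership in the class **UE** for the variety of semigroups: the rank of the fixed
point subsemigroup is uniformly bounded over all semigroup endomorphisms. -/
def InUESemigroup (S : Type*) [Semigroup S] : Prop :=
  ∃ N : ℕ, ∀ φ : S →ₙ* S, semigroupRank (fixSubsemigroup φ) ≤ (N : ℕ∞)

/-- The monoid presented by `⟨A | a₁a₂ = a₃a₄⟩`. -/
abbrev LengthTwoMonoid {A : Type*} (a₁ a₂ a₃ a₄ : A) : Type _ :=
  PresentedMonoid (fun u v : FreeMonoid A =>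
    u = FreeMonoid.of a₁ * FreeMonoid.of a₂ ∧ v = FreeMonoid.of a₃ * FreeMonoid.of a₄)

/-- The semigroup presented by `⟨A | a₁a₂ = a₃a₄⟩`: the quotient of the free semigroup on `A` by
the congruence generated by the pair `(a₁a₂, a₃a₄)`. -/
abbrev LengthTwoSemigroup {A : Type*} (a₁ a₂ a₃ a₄ : A) : Type _ :=
  (conGen (fun u v : FreeSemigroup A =>
    u = FreeSemigroup.of a₁ * FreeSemigroup.of a₂ ∧
      v = FreeSemigroup.of a₃ * FreeSemigroup.of a₄)).Quotient

/-! The proof replaces `φ` by a power whose fixed points have an explicit presentation, on which `φ`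
acts by permuting letters. Since lengths add, a factor of an element with bounded orbit has bounded
orbit, and by finiteness of `A` such an orbit is eventually periodic. So some `ψ = φ^N` is
idempotent on all elements of bounded orbit (`exists_iterate_retraction`), and `Fix φ ⊆ Fix ψ`. An
irreducible `r` of `Fix ψ` satisfies `r = ψ r`. In a word for `r`, exactly one letter is not killed
by `ψ`, and `ψ` sends it to `r`. Hence there are at most `|A|` irreducibles, and `Fix ψ` is either
free on them or presented by one relation between words of length two
(`exists_presentation_fixSubmonoid`). As `φ` maps irreducibles injectively to irreducibles
(`map_mem_irreducibles`), it remains to treat an endomorphism induced by an injection `σ` of the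
letters. Comparing first letters shows that its fixed points are generated by the fixed letters and
possibly `a₁a₂` (`closure_fixGenerators`). If `σ` moves a letter, that letter makes room for `a₁a₂`
in the count; otherwise the letters suffice. The semigroup embeds in the monoid by adjoining `1`, so
its bound follows. -/

namespace LengthTwoMonoid

/-! ### Letters, words and length. -/

variable {A : Type*} {a₁ a₂ a₃ a₄ : A}

/-- The image of a letter in the monoid `⟨A | a₁a₂ = a₃a₄⟩`. -/
def gen (a₁ a₂ a₃ a₄ : A) (x : A) : LengthTwoMonoid a₁ a₂ a₃ a₄ := PresentedMonoid.of _ x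

/-- The image of a word in the monoid `⟨A | a₁a₂ = a₃a₄⟩`. -/
def word (a₁ a₂ a₃ a₄ : A) : FreeMonoid A →* LengthTwoMonoid a₁ a₂ a₃ a₄ := PresentedMonoid.mk _

@[simp]
theorem word_of (x : A) : word a₁ a₂ a₃ a₄ (.of x) = gen a₁ a₂ a₃ a₄ x := rfl

theorem word_surjective : Function.Surjective (word a₁ a₂ a₃ a₄) :=
  PresentedMonoid.surjective_mk

theorem gen_rel :
    gen a₁ a₂ a₃ a₄ a₁ * gen a₁ a₂ a₃ a₄ a₂ = gen a₁ a₂ a₃ a₄ a₃ * gen a₁ a₂ a₃ a₄ a₄ :=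
  PresentedMonoid.mk_eq_mk_of_rel (rels := fun u v : FreeMonoid A =>
    u = FreeMonoid.of a₁ * FreeMonoid.of a₂ ∧ v = FreeMonoid.of a₃ * FreeMonoid.of a₄) ⟨rfl, rfl⟩

/-- The homomorphism determined by a map on letters that respects the defining relation. -/
def lift {N : Type*} [Monoid N] (f : A → N) (h : f a₁ * f a₂ = f a₃ * f a₄) :
    LengthTwoMonoid a₁ a₂ a₃ a₄ →* N :=
  PresentedMonoid.lift f (by rintro _ _ ⟨rfl, rfl⟩; simpa using h)

@[simp]
theorem lift_gen {N : Type*} [Monoid N] (f : A → N) (h : f a₁ * f a₂ = f a₃ * f a₄) (x : A) :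
    lift f h (gen a₁ a₂ a₃ a₄ x) = f x := rfl

theorem hom_ext {N : Type*} [Monoid N] {f g : LengthTwoMonoid a₁ a₂ a₃ a₄ →* N}
    (h : ∀ x, f (gen a₁ a₂ a₃ a₄ x) = g (gen a₁ a₂ a₃ a₄ x)) : f = g :=
  PresentedMonoid.ext _ h

@[elab_as_elim]
theorem induction_left {p : LengthTwoMonoid a₁ a₂ a₃ a₄ → Prop} (m : LengthTwoMonoid a₁ a₂ a₃ a₄)
    (one : p 1) (mul : ∀ x m, p m → p (gen a₁ a₂ a₃ a₄ x * m)) : p m :=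
  Submonoid.induction_of_closure_eq_top_left (PresentedMonoid.closure_range_of _) m one
    (by rintro _ ⟨x, rfl⟩ m hm; exact mul x m hm)

/-- The length of the words representing an element of `⟨A | a₁a₂ = a₃a₄⟩`. -/
def length (m : LengthTwoMonoid a₁ a₂ a₃ a₄) : ℕ :=
  (lift (a₁ := a₁) (a₂ := a₂) (a₃ := a₃) (a₄ := a₄)
    (fun _ => Multiplicative.ofAdd 1) rfl m).toAdd

@[simp]
theorem length_one : length (1 : LengthTwoMonoid a₁ a₂ a₃ a₄) = 0 := by
  simp [length]

@[simp]
theorem length_gen (x : A) : length (gen a₁ a₂ a₃ a₄ x) = 1 := rfl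

@[simp]
theorem length_mul (m n : LengthTwoMonoid a₁ a₂ a₃ a₄) :
    length (m * n) = length m + length n := by
  simp [length]

theorem length_word (w : FreeMonoid A) : length (word a₁ a₂ a₃ a₄ w) = w.length := by
  induction w with
  | one => simp
  | of x => simp
  | mul x y hx hy => simp [hx, hy, FreeMonoid.length_mul]

theorem length_eq_zero {m : LengthTwoMonoid a₁ a₂ a₃ a₄} : length m = 0 ↔ m = 1 := by
  refine ⟨fun h => ?_, fun h => by simp [h]⟩
  induction m using induction_left with
  | one => rfl
  | mul x m _ => simp at h

theorem eq_one_of_mul_eq_one {m n : LengthTwoMonoid a₁ a₂ a₃ a₄} (h : m * n = 1) :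
    m = 1 ∧ n = 1 := by
  have := congrArg length h
  simp only [length_mul, length_one, Nat.add_eq_zero_iff] at this
  exact ⟨length_eq_zero.1 this.1, length_eq_zero.1 this.2⟩

theorem exists_eq_gen_mul {m : LengthTwoMonoid a₁ a₂ a₃ a₄} (h : m ≠ 1) :
    ∃ x n, m = gen a₁ a₂ a₃ a₄ x * n := by
  induction m using induction_left with
  | one => exact absurd rfl h
  | mul x m _ => exact ⟨x, m, rfl⟩

/-! ### First letters and left cancellation. -/

/-- The ways in which products `x * u` and `y * v` with first letters `x` and `y` can agree. -/
def HeadEq (x y : A) (u v : LengthTwoMonoid a₁ a₂ a₃ a₄) : Prop :=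
  (x = y ∧ u = v) ∨
  (x = a₁ ∧ y = a₃ ∧ ∃ z, u = gen a₁ a₂ a₃ a₄ a₂ * z ∧ v = gen a₁ a₂ a₃ a₄ a₄ * z) ∨
  (x = a₃ ∧ y = a₁ ∧ ∃ z, u = gen a₁ a₂ a₃ a₄ a₄ * z ∧ v = gen a₁ a₂ a₃ a₄ a₂ * z)

theorem HeadEq.symm {x y : A} {u v : LengthTwoMonoid a₁ a₂ a₃ a₄} (h : HeadEq x y u v) :
    HeadEq y x v u := by
  rcases h with ⟨h, h'⟩ | ⟨h, h', z, hu, hv⟩ | ⟨h, h', z, hu, hv⟩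
  · exact .inl ⟨h.symm, h'.symm⟩
  · exact .inr (.inr ⟨h', h, z, hv, hu⟩)
  · exact .inr (.inl ⟨h', h, z, hv, hu⟩)

theorem HeadEq.mul {x y : A} {u v : LengthTwoMonoid a₁ a₂ a₃ a₄} (h : HeadEq x y u v)
    (t : LengthTwoMonoid a₁ a₂ a₃ a₄) : HeadEq x y (u * t) (v * t) := by
  rcases h with ⟨h, h'⟩ | ⟨h, h', z, hu, hv⟩ | ⟨h, h', z, hu, hv⟩
  · exact .inl ⟨h, by rw [h']⟩
  · exact .inr (.inl ⟨h, h', z * t, by rw [hu, mul_assoc], by rw [hv, mul_assoc]⟩)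
  · exact .inr (.inr ⟨h, h', z * t, by rw [hu, mul_assoc], by rw [hv, mul_assoc]⟩)

/-- A relation `a₁a₂ = a₁a₄` with `a₂ ≠ a₄` is the only obstruction to left cancellation, and `h`
excludes it. -/
theorem HeadEq.eq_of_same (h : a₁ = a₃ → a₂ = a₄) {x : A} {u v : LengthTwoMonoid a₁ a₂ a₃ a₄}
    (hx : HeadEq x x u v) : u = v := by
  rcases hx with ⟨_, h'⟩ | ⟨h₁, h₃, z, hu, hv⟩ | ⟨h₃, h₁, z, hu, hv⟩
  · exact h'
  all_goals
    rw [hu, hv, congrArg (gen a₁ a₂ a₃ a₄) (h (h₁.symm.trans h₃))]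

theorem HeadEq.trans (h : a₁ = a₃ → a₂ = a₄) {x y t : A} {u v w : LengthTwoMonoid a₁ a₂ a₃ a₄}
    (cancel : ∀ (s : A) (p q : LengthTwoMonoid a₁ a₂ a₃ a₄), gen a₁ a₂ a₃ a₄ s * p = v →
      gen a₁ a₂ a₃ a₄ s * q = v → p = q)
    (h₁ : HeadEq x y u v) (h₂ : HeadEq y t v w) : HeadEq x t u w := by
  rcases h₁ with ⟨rfl, rfl⟩ | ⟨hx, hy, z, hu, hv⟩ | ⟨hx, hy, z, hu, hv⟩
  · exact h₂
  · rcases h₂ with ⟨rfl, rfl⟩ | ⟨hy', ht, z', hv', hw⟩ | ⟨hy', ht, z', hv', hw⟩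
    · exact .inr (.inl ⟨hx, hy, z, hu, hv⟩)
    · have h13 : a₁ = a₃ := hy'.symm.trans hy
      have h24 := congrArg (gen a₁ a₂ a₃ a₄) (h h13)
      refine .inr (.inl ⟨hx, ht, z', ?_, hw⟩)
      rw [hu, h24, ← hv, hv', h24]
    · obtain rfl := cancel _ _ _ hv.symm hv'.symm
      exact .inl ⟨hx.trans ht.symm, hu.trans hw.symm⟩
  · rcases h₂ with ⟨rfl, rfl⟩ | ⟨hy', ht, z', hv', hw⟩ | ⟨hy', ht, z', hv', hw⟩
    · exact .inr (.inr ⟨hx, hy, z, hu, hv⟩)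
    · obtain rfl := cancel _ _ _ hv.symm hv'.symm
      exact .inl ⟨hx.trans ht.symm, hu.trans hw.symm⟩
    · have h13 : a₁ = a₃ := hy.symm.trans hy'
      have h24 := congrArg (gen a₁ a₂ a₃ a₄) (h h13)
      refine .inr (.inr ⟨hx, ht, z', ?_, hw⟩)
      rw [hu, ← h24, ← hv, hv', h24]

/-- The comparison of first letters survives every rule generating the congruence. Only transitivity
is delicate: it needs cancellation in the tail of the middle word, which is shorter, hence the outer
induction on length. -/
theorem headEq_of_word_eq (h : a₁ = a₃ → a₂ = a₄) (n : ℕ) : ∀ W V : FreeMonoid A,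
    word a₁ a₂ a₃ a₄ W = word a₁ a₂ a₃ a₄ V → W.length ≤ n → (W = 1 ∧ V = 1) ∨
      ∃ x y u v, W = .of x * u ∧ V = .of y * v ∧
        HeadEq x y (word a₁ a₂ a₃ a₄ u) (word a₁ a₂ a₃ a₄ v) := by
  induction n using Nat.strong_induction_on with
  | _ n ih =>
  -- The induction hypothesis, applied to two words with the same first letter, is already
  -- cancellation in smaller length.
  have cancel : ∀ (m : LengthTwoMonoid a₁ a₂ a₃ a₄), length m < n →
      ∀ (s : A) (p q : LengthTwoMonoid a₁ a₂ a₃ a₄), gen a₁ a₂ a₃ a₄ s * p = m →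
      gen a₁ a₂ a₃ a₄ s * q = m → p = q := by
    intro m hm s p q hp hq
    obtain ⟨p, rfl⟩ := word_surjective p
    obtain ⟨q, rfl⟩ := word_surjective q
    rcases ih (length m) hm (.of s * p) (.of s * q) (by simp [hp, hq])
      (by rw [← hp]; simp [length_word, FreeMonoid.length_mul]) with h1 | ⟨x, y, u, v, h1, h2, h3⟩
    · have := congrArg FreeMonoid.length h1.1
      simp [FreeMonoid.length_mul] at this
    · obtain ⟨rfl, rfl⟩ := List.cons.inj h1
      obtain ⟨rfl, rfl⟩ := List.cons.inj h2
      exact h3.eq_of_same h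
  intro W V hWV
  replace hWV := PresentedMonoid.mk_eq_mk_iff.1 hWV
  change ConGen.Rel _ W V at hWV
  have mk_eq : ∀ {W V : FreeMonoid A}, ConGen.Rel (fun u v : FreeMonoid A =>
      u = FreeMonoid.of a₁ * FreeMonoid.of a₂ ∧ v = FreeMonoid.of a₃ * FreeMonoid.of a₄) W V →
      word a₁ a₂ a₃ a₄ W = word a₁ a₂ a₃ a₄ V := fun hr => PresentedMonoid.mk_eq_mk_iff.2 hr
  have len_eq : ∀ {W V : FreeMonoid A}, ConGen.Rel (fun u v : FreeMonoid A =>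
      u = FreeMonoid.of a₁ * FreeMonoid.of a₂ ∧ v = FreeMonoid.of a₃ * FreeMonoid.of a₄) W V →
      W.length = V.length := fun hr => by
    rw [← length_word (a₁ := a₁) (a₂ := a₂) (a₃ := a₃) (a₄ := a₄), mk_eq hr, length_word]
  induction hWV with
  | of W V hr =>
    rintro -
    obtain ⟨rfl, rfl⟩ := hr
    exact .inr ⟨a₁, a₃, .of a₂, .of a₄, rfl, rfl, .inr (.inl ⟨rfl, rfl, 1, by simp, by simp⟩)⟩
  | refl W =>
    rintro -
    induction W using FreeMonoid.casesOn with
    | one => exact .inl ⟨rfl, rfl⟩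
    | of_mul x u => exact .inr ⟨x, x, u, u, rfl, rfl, .inl ⟨rfl, rfl⟩⟩
  | symm hr hi =>
    intro hl
    rcases hi (by rwa [len_eq hr]) with h1 | ⟨x, y, u, v, h1, h2, h3⟩
    · exact .inl h1.symm
    · exact .inr ⟨y, x, v, u, h2, h1, h3.symm⟩
  | @trans W V U hr hs hi hj =>
    intro hl
    have hl' : V.length ≤ n := by rwa [← len_eq hr]
    rcases hi hl with h1 | ⟨x, y, u, v, h1, h2, h3⟩
    · rcases hj hl' with h1' | ⟨x', y', u', v', h1', h2', h3'⟩
      · exact .inl ⟨h1.1, h1'.2⟩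
      · have := congrArg FreeMonoid.length (h1.2.symm.trans h1')
        simp only [FreeMonoid.length_one, FreeMonoid.length_mul, FreeMonoid.length_of] at this
        omega
    · rcases hj hl' with h1' | ⟨x', y', u', v', h1', h2', h3'⟩
      · have := congrArg FreeMonoid.length (h1'.1.symm.trans h2)
        simp only [FreeMonoid.length_one, FreeMonoid.length_mul, FreeMonoid.length_of] at this
        omega
      · obtain ⟨rfl, rfl⟩ := List.cons.inj (h2.symm.trans h1')
        refine .inr ⟨x, y', u, v', h1, h2', h3.trans h (cancel _ ?_) h3'⟩
        rw [length_word]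
        rw [h2, FreeMonoid.length_mul, FreeMonoid.length_of] at hl'
        omega
  | @mul W V W' V' hr hs hi hj =>
    intro hl
    rw [FreeMonoid.length_mul] at hl
    rcases hi (by omega) with ⟨rfl, rfl⟩ | ⟨x, y, u, v, rfl, rfl, h3⟩
    · simpa using hj (by omega)
    · refine .inr ⟨x, y, u * W', v * V', mul_assoc _ _ _, mul_assoc _ _ _, ?_⟩
      rw [map_mul, map_mul, ← mk_eq hs]
      exact h3.mul _

theorem headEq_of_gen_mul_eq (h : a₁ = a₃ → a₂ = a₄) {x y : A}
    {u v : LengthTwoMonoid a₁ a₂ a₃ a₄}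
    (e : gen a₁ a₂ a₃ a₄ x * u = gen a₁ a₂ a₃ a₄ y * v) : HeadEq x y u v := by
  obtain ⟨u, rfl⟩ := word_surjective u
  obtain ⟨v, rfl⟩ := word_surjective v
  rcases headEq_of_word_eq h _ (.of x * u) (.of y * v) (by simpa using e) le_rfl with
    h1 | ⟨x, y, u, v, h1, h2, h3⟩
  · have := congrArg FreeMonoid.length h1.1
    simp [FreeMonoid.length_mul] at this
  · obtain ⟨rfl, rfl⟩ := List.cons.inj h1
    obtain ⟨rfl, rfl⟩ := List.cons.inj h2
    exact h3

theorem gen_mul_left_cancel (h : a₁ = a₃ → a₂ = a₄) {x : A} {u v : LengthTwoMonoid a₁ a₂ a₃ a₄}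
    (e : gen a₁ a₂ a₃ a₄ x * u = gen a₁ a₂ a₃ a₄ x * v) : u = v :=
  (headEq_of_gen_mul_eq h e).eq_of_same h

/-! ### Endomorphisms that permute the letters. -/

/-- The fixed letters of `σ`, together with the element `a₁a₂` if it is fixed by `Φ`. -/
def fixGenerators (σ : A → A)
    (Φ : LengthTwoMonoid a₁ a₂ a₃ a₄ →* LengthTwoMonoid a₁ a₂ a₃ a₄) :
    Set (LengthTwoMonoid a₁ a₂ a₃ a₄) :=
  gen a₁ a₂ a₃ a₄ '' {x | σ x = x} ∪
    {m | m = gen a₁ a₂ a₃ a₄ a₁ * gen a₁ a₂ a₃ a₄ a₂ ∧ Φ m = m}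

/-- A fixed first letter can be cancelled. If the first letter is moved, the equality of `w` and `Φ
w` must use the relation at the front, so `w` begins with `a₁a₂`, which is then itself fixed and can
be cancelled. -/
theorem mem_closure_fixGenerators_of_left (h : a₁ = a₃ → a₂ = a₄) {σ : A → A}
    (hσ : Function.Injective σ)
    {Φ : LengthTwoMonoid a₁ a₂ a₃ a₄ →* LengthTwoMonoid a₁ a₂ a₃ a₄}
    (hΦ : ∀ x, Φ (gen a₁ a₂ a₃ a₄ x) = gen a₁ a₂ a₃ a₄ (σ x)) :
    ∀ (n : ℕ) (w : LengthTwoMonoid a₁ a₂ a₃ a₄), length w = n → Φ w = w →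
      w ∈ Submonoid.closure (fixGenerators σ Φ) := by
  intro n
  induction n using Nat.strong_induction_on with
  | _ n ih =>
  intro w hn hw
  by_cases h1 : w = 1
  · rw [h1]; exact one_mem _
  obtain ⟨x, u, rfl⟩ := exists_eq_gen_mul h1
  rw [length_mul, length_gen] at hn
  rw [map_mul, hΦ] at hw
  by_cases hx : σ x = x
  · rw [hx] at hw
    exact mul_mem (Submonoid.subset_closure (.inl ⟨x, hx, rfl⟩))
      (ih (length u) (by omega) u rfl (gen_mul_left_cancel h hw))
  have hR : Φ (gen a₁ a₂ a₃ a₄ a₁ * gen a₁ a₂ a₃ a₄ a₂) =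
      gen a₁ a₂ a₃ a₄ a₁ * gen a₁ a₂ a₃ a₄ a₂ ∧
      ∃ z, gen a₁ a₂ a₃ a₄ x * u = gen a₁ a₂ a₃ a₄ a₁ * gen a₁ a₂ a₃ a₄ a₂ * z := by
    have hrel := congrArg Φ (gen_rel (a₁ := a₁) (a₂ := a₂) (a₃ := a₃) (a₄ := a₄))
    -- Two-letter products that agree with different first letters are the two sides of the defining
    -- relation. Applied to the image of that relation under `Φ`, this shows that `a₁a₂` is fixed.
    have key : ∀ {p q r s : A}, gen a₁ a₂ a₃ a₄ p * gen a₁ a₂ a₃ a₄ r =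
        gen a₁ a₂ a₃ a₄ q * gen a₁ a₂ a₃ a₄ s → p ≠ q →
        gen a₁ a₂ a₃ a₄ p * gen a₁ a₂ a₃ a₄ r = gen a₁ a₂ a₃ a₄ a₁ * gen a₁ a₂ a₃ a₄ a₂ := by
      intro p q r s e hpq
      rcases headEq_of_gen_mul_eq h e with ⟨h', _⟩ | ⟨hp, hq, z, hu, hv⟩ | ⟨hp, hq, z, hu, hv⟩
      · exact absurd h' hpq
      · have hz : length z = 0 := by simpa using congrArg length hu
        rw [length_eq_zero.1 hz, mul_one] at hu
        rw [hp, hu]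
      · have hz : length z = 0 := by simpa using congrArg length hu
        rw [length_eq_zero.1 hz, mul_one] at hu
        rw [hp, hu, gen_rel]
    simp only [map_mul, hΦ] at hrel ⊢
    rcases headEq_of_gen_mul_eq h hw with ⟨h', _⟩ | ⟨h1, h3, z, hu, hv⟩ | ⟨h3, h1, z, hu, hv⟩
    · exact absurd h' hx
    · refine ⟨key hrel fun e => hx ?_, z, ?_⟩
      · rw [h1, h3, hσ e]
      · rw [h3, hv, ← mul_assoc, gen_rel]
    · refine ⟨key hrel fun e => hx ?_, z, ?_⟩
      · exact (h3.trans (hσ e).symm).trans h1.symm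
      · rw [h1, hv, ← mul_assoc]
  obtain ⟨hR, z, hz⟩ := hR
  rw [← hΦ, ← map_mul, hz, map_mul, hR, mul_assoc, mul_assoc] at hw
  rw [hz]
  have hlen := congrArg length hz
  simp only [length_mul, length_gen] at hlen
  exact mul_mem (Submonoid.subset_closure (.inr ⟨rfl, hR⟩))
    (ih (length z) (by omega) z rfl (gen_mul_left_cancel h (gen_mul_left_cancel h hw)))

/-- Reversal of words, as an antihomomorphism. -/
def reverse (a₁ a₂ a₃ a₄ : A) :
    LengthTwoMonoid a₁ a₂ a₃ a₄ →* (LengthTwoMonoid a₂ a₁ a₄ a₃)ᵐᵒᵖ :=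
  lift (fun x => .op (gen a₂ a₁ a₄ a₃ x)) (by
    rw [← MulOpposite.op_mul, ← MulOpposite.op_mul, gen_rel])

theorem unop_reverse_mul (m n : LengthTwoMonoid a₁ a₂ a₃ a₄) :
    (reverse a₁ a₂ a₃ a₄ (m * n)).unop =
      (reverse a₁ a₂ a₃ a₄ n).unop * (reverse a₁ a₂ a₃ a₄ m).unop := by
  rw [map_mul, MulOpposite.unop_mul]

@[simp]
theorem unop_reverse_gen (x : A) :
    (reverse a₁ a₂ a₃ a₄ (gen a₁ a₂ a₃ a₄ x)).unop = gen a₂ a₁ a₄ a₃ x := rfl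

theorem reverse_reverse (m : LengthTwoMonoid a₁ a₂ a₃ a₄) :
    (reverse a₂ a₁ a₄ a₃ (reverse a₁ a₂ a₃ a₄ m).unop).unop = m := by
  induction m using induction_left with
  | one => simp
  | mul x m ih => rw [unop_reverse_mul, unop_reverse_mul, ih]; simp

/-- Reversing words turns right cancellation into left cancellation and conjugates `Φ` to the
endomorphism `Ψ` induced by the same `σ`. -/
theorem mem_closure_fixGenerators_of_right (h : a₂ = a₄ → a₁ = a₃) {σ : A → A}
    (hσ : Function.Injective σ)
    {Φ : LengthTwoMonoid a₁ a₂ a₃ a₄ →* LengthTwoMonoid a₁ a₂ a₃ a₄}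
    (hΦ : ∀ x, Φ (gen a₁ a₂ a₃ a₄ x) = gen a₁ a₂ a₃ a₄ (σ x))
    (w : LengthTwoMonoid a₁ a₂ a₃ a₄) (hw : Φ w = w) :
    w ∈ Submonoid.closure (fixGenerators σ Φ) := by
  have hrel := congrArg Φ (gen_rel (a₁ := a₁) (a₂ := a₂) (a₃ := a₃) (a₄ := a₄))
  replace hrel := congrArg (fun m => (reverse a₁ a₂ a₃ a₄ m).unop) hrel
  simp only [map_mul, hΦ, MulOpposite.unop_mul, unop_reverse_gen] at hrel
  let Ψ : LengthTwoMonoid a₂ a₁ a₄ a₃ →* LengthTwoMonoid a₂ a₁ a₄ a₃ :=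
    lift (fun x => gen a₂ a₁ a₄ a₃ (σ x)) hrel
  have hΨ : ∀ x, Ψ (gen a₂ a₁ a₄ a₃ x) = gen a₂ a₁ a₄ a₃ (σ x) := fun x => rfl
  have comm : ∀ m, Ψ (reverse a₁ a₂ a₃ a₄ m).unop = (reverse a₁ a₂ a₃ a₄ (Φ m)).unop := by
    intro m
    induction m using induction_left with
    | one => simp
    | mul x m ih => rw [unop_reverse_mul, map_mul, ih, map_mul, unop_reverse_mul, hΦ]; simp [hΨ]
  have := mem_closure_fixGenerators_of_left h hσ hΨ _ (reverse a₁ a₂ a₃ a₄ w).unop rfl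
    (by rw [comm, hw])
  rw [← reverse_reverse w]
  generalize (reverse a₁ a₂ a₃ a₄ w).unop = w' at this
  induction this using Submonoid.closure_induction with
  | mem m hm =>
    rcases hm with ⟨x, hx, rfl⟩ | ⟨rfl, hm⟩
    · exact Submonoid.subset_closure (.inl ⟨x, hx, rfl⟩)
    · refine Submonoid.subset_closure (.inr ⟨by rw [unop_reverse_mul]; simp, ?_⟩)
      rw [unop_reverse_mul, unop_reverse_gen, unop_reverse_gen, map_mul, hΦ, hΦ]
      rw [map_mul, hΨ, hΨ] at hm
      replace hm := congrArg (fun m => (reverse a₂ a₁ a₄ a₃ m).unop) hm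
      simpa using hm
  | one => simp
  | mul m n _ _ hm hn => rw [unop_reverse_mul]; exact mul_mem hn hm

theorem closure_fixGenerators {σ : A → A} (hσ : Function.Injective σ)
    {Φ : LengthTwoMonoid a₁ a₂ a₃ a₄ →* LengthTwoMonoid a₁ a₂ a₃ a₄}
    (hΦ : ∀ x, Φ (gen a₁ a₂ a₃ a₄ x) = gen a₁ a₂ a₃ a₄ (σ x)) :
    Submonoid.closure (fixGenerators σ Φ) = fixSubmonoid Φ := by
  apply le_antisymm
  · rw [Submonoid.closure_le]
    rintro _ (⟨x, hx, rfl⟩ | ⟨rfl, hm⟩)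
    · exact (hΦ x).trans (congrArg _ hx)
    · exact hm
  · intro w hw
    by_cases h : a₁ = a₃ → a₂ = a₄
    · exact mem_closure_fixGenerators_of_left h hσ hΦ _ w rfl hw
    -- Left cancellation fails only when `a₂ ≠ a₄`, and then the hypothesis of the right-hand
    -- version holds vacuously.
    · push Not at h
      exact mem_closure_fixGenerators_of_right (fun h' => absurd h' h.2) hσ hΦ w hw

/-- An endomorphism permuting the letters has its fixed points generated by at most as many
elements as there are letters. -/
theorem exists_closure_eq_fixSubmonoid_of_perm {σ : A → A} (hσ : Function.Injective σ)
    {Φ : LengthTwoMonoid a₁ a₂ a₃ a₄ →* LengthTwoMonoid a₁ a₂ a₃ a₄}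
    (hΦ : ∀ x, Φ (gen a₁ a₂ a₃ a₄ x) = gen a₁ a₂ a₃ a₄ (σ x)) :
    ∃ B : Set (LengthTwoMonoid a₁ a₂ a₃ a₄),
      Submonoid.closure B = fixSubmonoid Φ ∧ B.encard ≤ ENat.card A := by
  by_cases hall : ∀ x, σ x = x
  · refine ⟨Set.range (gen a₁ a₂ a₃ a₄), ?_, ?_⟩
    · refine (PresentedMonoid.closure_range_of _).trans (Eq.symm (top_unique fun w _ => ?_))
      have : Φ = MonoidHom.id _ := hom_ext fun x => by rw [hΦ, hall]; rfl
      show Φ w = w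
      rw [this]; rfl
    · rw [← Set.image_univ, ← Set.encard_univ]
      exact Set.encard_image_le _ _
  -- The moved letter `y` is not among the fixed ones, which leaves one place for `a₁a₂`.
  · push Not at hall
    obtain ⟨y, hy⟩ := hall
    refine ⟨_, closure_fixGenerators hσ hΦ, ?_⟩
    calc (fixGenerators σ Φ).encard
        ≤ (gen a₁ a₂ a₃ a₄ '' {x | σ x = x}).encard +
          ({m | m = gen a₁ a₂ a₃ a₄ a₁ * gen a₁ a₂ a₃ a₄ a₂ ∧ Φ m = m}).encard :=
          Set.encard_union_le _ _
      _ ≤ {x | σ x = x}.encard + 1 := by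
          refine add_le_add (Set.encard_image_le _ _) (Set.encard_le_one_iff.2 ?_)
          rintro m n ⟨hm, -⟩ ⟨hn, -⟩
          rw [hm, hn]
      _ = (insert y {x | σ x = x}).encard := (Set.encard_insert_of_notMem (by simpa using hy)).symm
      _ ≤ ENat.card A := by rw [← Set.encard_univ]; exact Set.encard_le_encard (Set.subset_univ _)

/-! ### Irreducible elements of a submonoid. -/

/-- The elements of a submonoid that are not products of two nontrivial elements of it. -/
def irreducibles (P : Submonoid (LengthTwoMonoid a₁ a₂ a₃ a₄)) :
    Set (LengthTwoMonoid a₁ a₂ a₃ a₄) :=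
  {r | r ∈ P ∧ r ≠ 1 ∧ ∀ s ∈ P, ∀ t ∈ P, r = s * t → s = 1 ∨ t = 1}

/-- The product in the monoid of a word of irreducible elements. -/
def irreducibleProd (P : Submonoid (LengthTwoMonoid a₁ a₂ a₃ a₄)) :
    FreeMonoid (irreducibles P) →* LengthTwoMonoid a₁ a₂ a₃ a₄ :=
  FreeMonoid.lift Subtype.val

section Irreducibles

variable {P : Submonoid (LengthTwoMonoid a₁ a₂ a₃ a₄)}

@[simp]
theorem irreducibleProd_of (r : irreducibles P) : irreducibleProd P (.of r) = r := rfl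

theorem irreducibleProd_mem (g : FreeMonoid (irreducibles P)) : irreducibleProd P g ∈ P := by
  induction g with
  | one => simp
  | of r => exact r.2.1
  | mul x y hx hy => rw [map_mul]; exact mul_mem hx hy

theorem exists_irreducibleProd_eq {m : LengthTwoMonoid a₁ a₂ a₃ a₄} (hm : m ∈ P) :
    ∃ g, irreducibleProd P g = m := by
  induction hn : length m using Nat.strong_induction_on generalizing m with
  | _ n ih =>
  by_cases h1 : m = 1
  · exact ⟨1, by simp [h1]⟩
  by_cases hirr : m ∈ irreducibles P
  · exact ⟨.of ⟨m, hirr⟩, rfl⟩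
  have : ∃ s ∈ P, ∃ t ∈ P, m = s * t ∧ s ≠ 1 ∧ t ≠ 1 := by
    by_contra! hcon
    exact hirr ⟨hm, h1, fun s hs t ht e => or_iff_not_imp_left.2 (hcon s hs t ht e)⟩
  obtain ⟨s, hs, t, ht, rfl, hs1, ht1⟩ := this
  rw [length_mul] at hn
  have hs0 := mt length_eq_zero.1 hs1
  have ht0 := mt length_eq_zero.1 ht1
  obtain ⟨g, hg⟩ := ih _ (by omega) hs rfl
  obtain ⟨g', hg'⟩ := ih _ (by omega) ht rfl
  exact ⟨g * g', by rw [map_mul, hg, hg']⟩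

theorem eq_one_of_irreducibleProd_eq_one {g : FreeMonoid (irreducibles P)}
    (h : irreducibleProd P g = 1) : g = 1 := by
  induction g using FreeMonoid.casesOn with
  | one => rfl
  | of_mul r g =>
    rw [map_mul, irreducibleProd_of] at h
    exact absurd (eq_one_of_mul_eq_one h).1 r.2.2.1

/-- Uniqueness of factorisation for `1` and for irreducibles; only one of the two words has to be
short. -/
theorem irreducibleProd_injOn {g g' : FreeMonoid (irreducibles P)} (hg : g.length ≤ 1)
    (h : irreducibleProd P g = irreducibleProd P g') : g = g' := by
  rcases Nat.le_one_iff_eq_zero_or_eq_one.1 hg with h0 | h1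
  · obtain rfl := FreeMonoid.length_eq_zero.1 h0
    rw [map_one] at h
    exact (eq_one_of_irreducibleProd_eq_one h.symm).symm
  · obtain ⟨r, rfl⟩ := FreeMonoid.length_eq_one.1 h1
    rw [irreducibleProd_of] at h
    induction g' using FreeMonoid.casesOn with
    | one => exact absurd h r.2.2.1
    | of_mul r' g' =>
      rw [map_mul, irreducibleProd_of] at h
      have := (r.2.2.2 _ r'.2.1 _ (irreducibleProd_mem g') h).resolve_left r'.2.2.1
      obtain rfl := eq_one_of_irreducibleProd_eq_one this
      rw [map_one, mul_one] at h
      rw [mul_one, Subtype.ext h]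

end Irreducibles

/-! ### A presentation of the fixed points of a retraction. -/

section Retract

variable {ψ : LengthTwoMonoid a₁ a₂ a₃ a₄ →* LengthTwoMonoid a₁ a₂ a₃ a₄}

theorem map_eq_one_of_map_eq_one {N : Type*} [Monoid N] {s : LengthTwoMonoid a₁ a₂ a₃ a₄ →* N}
    (hs : ∀ x, ψ (gen a₁ a₂ a₃ a₄ x) = 1 → s (gen a₁ a₂ a₃ a₄ x) = 1)
    {m : LengthTwoMonoid a₁ a₂ a₃ a₄} (hm : ψ m = 1) : s m = 1 := by
  induction m using induction_left with
  | one => simp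
  | mul x m ih =>
    rw [map_mul] at hm
    rw [map_mul, hs x (eq_one_of_mul_eq_one hm).1, ih (eq_one_of_mul_eq_one hm).2, one_mul]

/-- By `H` both `ψ m` and `ψ n` lie in `Fix ψ`, so they factor the irreducible `r` there. -/
theorem map_eq_one_or_map_eq_one
    (H : ∀ m n, ψ (ψ (m * n)) = ψ (m * n) → ψ (ψ m) = ψ m ∧ ψ (ψ n) = ψ n)
    {r m n : LengthTwoMonoid a₁ a₂ a₃ a₄}
    (hr : r ∈ irreducibles (fixSubmonoid ψ)) (h : ψ (m * n) = r) : ψ m = 1 ∨ ψ n = 1 := by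
  have hP : ψ r = r := hr.1
  obtain ⟨hm, hn⟩ := H m n (by rw [h, hP])
  exact hr.2.2 _ hm _ hn (by rw [← h, map_mul])

/-- A homomorphism is determined on an irreducible fixed point of `ψ` by its values on the letters
that `ψ` maps to that point or to `1`. -/
theorem map_eq_of_map_eq_irreducible
    (H : ∀ m n, ψ (ψ (m * n)) = ψ (m * n) → ψ (ψ m) = ψ m ∧ ψ (ψ n) = ψ n)
    {N : Type*} [Monoid N]
    {s : LengthTwoMonoid a₁ a₂ a₃ a₄ →* N}
    (hs : ∀ x, ψ (gen a₁ a₂ a₃ a₄ x) = 1 → s (gen a₁ a₂ a₃ a₄ x) = 1)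
    {r : LengthTwoMonoid a₁ a₂ a₃ a₄} (hr : r ∈ irreducibles (fixSubmonoid ψ)) {q : N}
    (hq : ∀ x, ψ (gen a₁ a₂ a₃ a₄ x) = r → s (gen a₁ a₂ a₃ a₄ x) = q)
    {m : LengthTwoMonoid a₁ a₂ a₃ a₄} (hm : ψ m = r) : s m = q := by
  induction m using induction_left with
  | one => exact absurd ((map_one ψ).symm.trans hm).symm hr.2.1
  | mul x m ih =>
    rcases map_eq_one_or_map_eq_one H hr hm with h1 | h1
    · rw [map_mul, hs x h1, one_mul, ih (by rw [← hm, map_mul, h1, one_mul])]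
    · rw [map_mul, map_eq_one_of_map_eq_one hs h1, mul_one,
        hq x (by rw [← hm, map_mul, h1, mul_one])]

theorem exists_gen_of_irreducible
    (H : ∀ m n, ψ (ψ (m * n)) = ψ (m * n) → ψ (ψ m) = ψ m ∧ ψ (ψ n) = ψ n)
    {r : LengthTwoMonoid a₁ a₂ a₃ a₄}
    (hr : r ∈ irreducibles (fixSubmonoid ψ)) : ∃ x, ψ (gen a₁ a₂ a₃ a₄ x) = r := by
  suffices ∀ m, ψ m = r → ∃ x, ψ (gen a₁ a₂ a₃ a₄ x) = r from this r hr.1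
  intro m hm
  induction m using induction_left with
  | one => exact absurd ((map_one ψ).symm.trans hm).symm hr.2.1
  | mul x m ih =>
    rcases map_eq_one_or_map_eq_one H hr hm with h1 | h1
    · exact ih (by rw [← hm, map_mul, h1, one_mul])
    · exact ⟨x, by rw [← hm, map_mul, h1, mul_one]⟩

open Classical in
/-- The word of irreducible fixed points of length at most one representing the image of a letter
under `ψ`, and `0` if there is none. -/
noncomputable def letterWord (ψ : LengthTwoMonoid a₁ a₂ a₃ a₄ →* LengthTwoMonoid a₁ a₂ a₃ a₄)
    (x : A) : WithZero (FreeMonoid (irreducibles (fixSubmonoid ψ))) :=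
  if ψ (gen a₁ a₂ a₃ a₄ x) = 1 then 1
  else if h : ψ (gen a₁ a₂ a₃ a₄ x) ∈ irreducibles (fixSubmonoid ψ) then
    ((FreeMonoid.of ⟨_, h⟩ : FreeMonoid (irreducibles (fixSubmonoid ψ))) : WithZero _)
  else 0

theorem letterWord_of_eq_one {x : A} (h : ψ (gen a₁ a₂ a₃ a₄ x) = 1) : letterWord ψ x = 1 :=
  if_pos h

theorem letterWord_of_irreducible {x : A}
    (h : ψ (gen a₁ a₂ a₃ a₄ x) ∈ irreducibles (fixSubmonoid ψ)) :
    letterWord ψ x = ((FreeMonoid.of ⟨_, h⟩ : FreeMonoid (irreducibles (fixSubmonoid ψ))) : WithZero _) := by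
  rw [letterWord, if_neg h.2.1, dif_pos h]

theorem letterWord_eq_coe {x : A} (h : letterWord ψ x ≠ 0) :
    ∃ g : FreeMonoid (irreducibles (fixSubmonoid ψ)), letterWord ψ x = g ∧
      irreducibleProd _ g = ψ (gen a₁ a₂ a₃ a₄ x) ∧ g.length ≤ 1 := by
  by_cases h1 : ψ (gen a₁ a₂ a₃ a₄ x) = 1
  · exact ⟨1, letterWord_of_eq_one h1, by simp [h1], by simp⟩
  by_cases h2 : ψ (gen a₁ a₂ a₃ a₄ x) ∈ irreducibles (fixSubmonoid ψ)
  · exact ⟨_, letterWord_of_irreducible h2, rfl, by simp⟩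
  · exact absurd (by rw [letterWord, if_neg h1, dif_neg h2]) h

/-- `s` agrees with `letterWord ψ` wherever the latter is nonzero. -/
def Extends (ψ : LengthTwoMonoid a₁ a₂ a₃ a₄ →* LengthTwoMonoid a₁ a₂ a₃ a₄)
    (s : A → WithZero (FreeMonoid (irreducibles (fixSubmonoid ψ)))) : Prop :=
  ∀ x, letterWord ψ x ≠ 0 → s x = letterWord ψ x

/-- A letter with value `0` is unconstrained, so it may be given the value of the opposite side of
the relation. -/
theorem exists_extends_of_update {p q r s : A} (hp : letterWord ψ p ≠ 0) (hq : letterWord ψ q ≠ 0)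
    (h : letterWord ψ r = 1 ∧ letterWord ψ s = 0 ∨ letterWord ψ s = 1 ∧ letterWord ψ r = 0) :
    ∃ f, Extends ψ f ∧ f p * f q = f r * f s := by
  classical
  rcases h with ⟨h1, h0⟩ | ⟨h1, h0⟩
  · refine ⟨Function.update (letterWord ψ) s (letterWord ψ p * letterWord ψ q), fun x hx => ?_, ?_⟩
    · exact Function.update_of_ne (by rintro rfl; exact hx h0) _ _
    · rw [Function.update_of_ne (by rintro rfl; exact hp h0),
        Function.update_of_ne (by rintro rfl; exact hq h0),
        Function.update_of_ne (by rintro rfl; simp [h1] at h0), Function.update_self, h1, one_mul]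
  · refine ⟨Function.update (letterWord ψ) r (letterWord ψ p * letterWord ψ q), fun x hx => ?_, ?_⟩
    · exact Function.update_of_ne (by rintro rfl; exact hx h0) _ _
    · rw [Function.update_of_ne (by rintro rfl; exact hp h0),
        Function.update_of_ne (by rintro rfl; exact hq h0), Function.update_self,
        Function.update_of_ne (by rintro rfl; simp [h1] at h0), h1, mul_one]

/-- Counting the letters not killed by `ψ` gives every irreducible weight one, so words in
irreducibles with equal products have equal length. -/
theorem map_irreducibleProd
    (H : ∀ m n, ψ (ψ (m * n)) = ψ (m * n) → ψ (ψ m) = ψ m ∧ ψ (ψ n) = ψ n)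
    {ℓ : LengthTwoMonoid a₁ a₂ a₃ a₄ →* Multiplicative ℕ}
    (h1 : ∀ x, ψ (gen a₁ a₂ a₃ a₄ x) = 1 → ℓ (gen a₁ a₂ a₃ a₄ x) = 1)
    (h2 : ∀ x, ψ (gen a₁ a₂ a₃ a₄ x) ≠ 1 → ℓ (gen a₁ a₂ a₃ a₄ x) = .ofAdd 1)
    (g : FreeMonoid (irreducibles (fixSubmonoid ψ))) :
    ℓ (irreducibleProd _ g) = .ofAdd g.length := by
  induction g with
  | one => simp
  | of r =>
    exact map_eq_of_map_eq_irreducible H h1 r.2 (fun x hx => h2 x (by rw [hx]; exact r.2.2.1)) r.2.1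
  | mul x y hx hy => rw [map_mul, map_mul, hx, hy, FreeMonoid.length_mul, ofAdd_add]

/-- If `ψ` kills `r` or `s`, the other letter is reassigned. Otherwise `ψ r` and `ψ s` are
nontrivial elements of `Fix ψ` whose product is a product of at most two irreducibles; counting by
`ℓ` makes both irreducible, contradicting `hz`. -/
theorem exists_extends_of_one_side
    (H : ∀ m n, ψ (ψ (m * n)) = ψ (m * n) → ψ (ψ m) = ψ m ∧ ψ (ψ n) = ψ n)
    {p q r s : A}
    (hrel : gen a₁ a₂ a₃ a₄ p * gen a₁ a₂ a₃ a₄ q = gen a₁ a₂ a₃ a₄ r * gen a₁ a₂ a₃ a₄ s)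
    (hℓ : ψ (gen a₁ a₂ a₃ a₄ p) ≠ 1 → ψ (gen a₁ a₂ a₃ a₄ q) ≠ 1 → ψ (gen a₁ a₂ a₃ a₄ r) ≠ 1 →
      ψ (gen a₁ a₂ a₃ a₄ s) ≠ 1 → ∃ ℓ : LengthTwoMonoid a₁ a₂ a₃ a₄ →* Multiplicative ℕ,
        (∀ x, ψ (gen a₁ a₂ a₃ a₄ x) = 1 → ℓ (gen a₁ a₂ a₃ a₄ x) = 1) ∧
        ∀ x, ψ (gen a₁ a₂ a₃ a₄ x) ≠ 1 → ℓ (gen a₁ a₂ a₃ a₄ x) = .ofAdd 1)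
    (hp : letterWord ψ p ≠ 0) (hq : letterWord ψ q ≠ 0)
    (hz : letterWord ψ r = 0 ∨ letterWord ψ s = 0) :
    ∃ f, Extends ψ f ∧ f p * f q = f r * f s := by
  by_cases hr1 : ψ (gen a₁ a₂ a₃ a₄ r) = 1
  · have := letterWord_of_eq_one hr1
    exact exists_extends_of_update hp hq (.inl ⟨this, hz.resolve_left (by simp [this])⟩)
  by_cases hs1 : ψ (gen a₁ a₂ a₃ a₄ s) = 1
  · have := letterWord_of_eq_one hs1
    exact exists_extends_of_update hp hq (.inr ⟨this, hz.resolve_right (by simp [this])⟩)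
  exfalso
  obtain ⟨g₁, -, hg₁, hl₁⟩ := letterWord_eq_coe hp
  obtain ⟨g₂, -, hg₂, hl₂⟩ := letterWord_eq_coe hq
  have hfix : ∀ {m}, m ∈ fixSubmonoid ψ → ψ m = m := fun h => h
  obtain ⟨hr, hs⟩ := H (gen a₁ a₂ a₃ a₄ r) (gen a₁ a₂ a₃ a₄ s) (by
    rw [← hrel, map_mul, ← hg₁, ← hg₂, ← map_mul]
    exact hfix (irreducibleProd_mem _))
  obtain ⟨g₃, hg₃⟩ := exists_irreducibleProd_eq (P := fixSubmonoid ψ) hr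
  obtain ⟨g₄, hg₄⟩ := exists_irreducibleProd_eq (P := fixSubmonoid ψ) hs
  have hprod : irreducibleProd _ (g₁ * g₂) = irreducibleProd _ (g₃ * g₄) := by
    rw [map_mul, map_mul, hg₁, hg₂, hg₃, hg₄, ← map_mul, ← map_mul, hrel]
  have h₃ : g₃.length ≠ 0 := fun h => hr1 (by
    rw [← hg₃, FreeMonoid.length_eq_zero.1 h, map_one])
  have h₄ : g₄.length ≠ 0 := fun h => hs1 (by
    rw [← hg₄, FreeMonoid.length_eq_zero.1 h, map_one])
  by_cases hshort : (g₁ * g₂).length ≤ 1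
  · have := congrArg FreeMonoid.length (irreducibleProd_injOn hshort hprod)
    rw [FreeMonoid.length_mul g₃] at this
    omega
  rw [FreeMonoid.length_mul] at hshort
  have hp1 : ψ (gen a₁ a₂ a₃ a₄ p) ≠ 1 := fun h => by
    rw [← hg₁] at h
    rw [eq_one_of_irreducibleProd_eq_one h, FreeMonoid.length_one] at hshort
    omega
  have hq1 : ψ (gen a₁ a₂ a₃ a₄ q) ≠ 1 := fun h => by
    rw [← hg₂] at h
    rw [eq_one_of_irreducibleProd_eq_one h, FreeMonoid.length_one] at hshort
    omega
  obtain ⟨ℓ, h1, h2⟩ := hℓ hp1 hq1 hr1 hs1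
  have hlen := congrArg ℓ hprod
  rw [map_irreducibleProd H h1 h2, map_irreducibleProd H h1 h2] at hlen
  replace hlen := Multiplicative.ofAdd.injective hlen
  rw [FreeMonoid.length_mul, FreeMonoid.length_mul] at hlen
  have key : ∀ {x : A} {g : FreeMonoid (irreducibles (fixSubmonoid ψ))}, g.length = 1 →
      irreducibleProd _ g = ψ (gen a₁ a₂ a₃ a₄ x) → letterWord ψ x ≠ 0 := by
    intro x g hg hx
    obtain ⟨i, rfl⟩ := FreeMonoid.length_eq_one.1 hg
    rw [letterWord_of_irreducible (by rw [← hx]; exact i.2)]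
    exact WithZero.coe_ne_zero
  rcases hz with hz | hz
  · exact key (by omega) hg₃ hz
  · exact key (by omega) hg₄ hz

/-- Unless all four letters have irreducible images, the relation can be respected already over the
free monoid on the irreducibles with a zero adjoined. The zero absorbs letters whose images are
neither trivial nor irreducible fixed points. -/
theorem exists_extends
    (H : ∀ m n, ψ (ψ (m * n)) = ψ (m * n) → ψ (ψ m) = ψ m ∧ ψ (ψ n) = ψ n)
    (hnot : ¬ (ψ (gen a₁ a₂ a₃ a₄ a₁) ∈ irreducibles (fixSubmonoid ψ) ∧
      ψ (gen a₁ a₂ a₃ a₄ a₂) ∈ irreducibles (fixSubmonoid ψ) ∧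
      ψ (gen a₁ a₂ a₃ a₄ a₃) ∈ irreducibles (fixSubmonoid ψ) ∧
      ψ (gen a₁ a₂ a₃ a₄ a₄) ∈ irreducibles (fixSubmonoid ψ))) :
    ∃ f, Extends ψ f ∧ f a₁ * f a₂ = f a₃ * f a₄ := by
  classical
  have hℓ : ψ (gen a₁ a₂ a₃ a₄ a₁) ≠ 1 → ψ (gen a₁ a₂ a₃ a₄ a₂) ≠ 1 →
      ψ (gen a₁ a₂ a₃ a₄ a₃) ≠ 1 → ψ (gen a₁ a₂ a₃ a₄ a₄) ≠ 1 →
      ∃ ℓ : LengthTwoMonoid a₁ a₂ a₃ a₄ →* Multiplicative ℕ,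
        (∀ x, ψ (gen a₁ a₂ a₃ a₄ x) = 1 → ℓ (gen a₁ a₂ a₃ a₄ x) = 1) ∧
        ∀ x, ψ (gen a₁ a₂ a₃ a₄ x) ≠ 1 → ℓ (gen a₁ a₂ a₃ a₄ x) = .ofAdd 1 := by
    intro h1 h2 h3 h4
    refine ⟨lift (fun x => if ψ (gen a₁ a₂ a₃ a₄ x) = 1 then 1 else .ofAdd 1) ?_, ?_, ?_⟩
    · simp only [if_neg h1, if_neg h2, if_neg h3, if_neg h4]
    · intro x hx
      rw [lift_gen, if_pos hx]
    · intro x hx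
      rw [lift_gen, if_neg hx]
  by_cases h12 : letterWord ψ a₁ = 0 ∨ letterWord ψ a₂ = 0
  · by_cases h34 : letterWord ψ a₃ = 0 ∨ letterWord ψ a₄ = 0
    · exact ⟨_, fun x _ => rfl, by rw [mul_eq_zero.2 h12, mul_eq_zero.2 h34]⟩
    · push Not at h34
      obtain ⟨f, hf, he⟩ := exists_extends_of_one_side H gen_rel.symm
        (fun h3 h4 h1 h2 => hℓ h1 h2 h3 h4) h34.1 h34.2 h12
      exact ⟨f, hf, he.symm⟩
  · push Not at h12
    by_cases h34 : letterWord ψ a₃ = 0 ∨ letterWord ψ a₄ = 0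
    · exact exists_extends_of_one_side H gen_rel hℓ h12.1 h12.2 h34
    · push Not at h34
      refine ⟨_, fun x _ => rfl, ?_⟩
      obtain ⟨g₁, e₁, hg₁, hl₁⟩ := letterWord_eq_coe h12.1
      obtain ⟨g₂, e₂, hg₂, hl₂⟩ := letterWord_eq_coe h12.2
      obtain ⟨g₃, e₃, hg₃, hl₃⟩ := letterWord_eq_coe h34.1
      obtain ⟨g₄, e₄, hg₄, hl₄⟩ := letterWord_eq_coe h34.2
      have hprod : irreducibleProd _ (g₁ * g₂) = irreducibleProd _ (g₃ * g₄) := by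
        rw [map_mul, map_mul, hg₁, hg₂, hg₃, hg₄, ← map_mul, ← map_mul, gen_rel]
      rw [e₁, e₂, e₃, e₄, ← WithZero.coe_mul, ← WithZero.coe_mul, WithZero.coe_inj]
      have key : ∀ {x : A} {g : FreeMonoid (irreducibles (fixSubmonoid ψ))}, g.length = 1 →
          irreducibleProd _ g = ψ (gen a₁ a₂ a₃ a₄ x) →
          ψ (gen a₁ a₂ a₃ a₄ x) ∈ irreducibles (fixSubmonoid ψ) := by
        intro x g hg hx
        obtain ⟨i, rfl⟩ := FreeMonoid.length_eq_one.1 hg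
        rw [← hx]; exact i.2
      by_cases h2 : (g₁ * g₂).length ≤ 1
      · exact irreducibleProd_injOn h2 hprod
      by_cases h2' : (g₃ * g₄).length ≤ 1
      · exact (irreducibleProd_injOn h2' hprod.symm).symm
      rw [FreeMonoid.length_mul] at h2 h2'
      exact absurd ⟨key (by omega) hg₁, key (by omega) hg₂, key (by omega) hg₃,
        key (by omega) hg₄⟩ hnot

/-- On an irreducible `r`, the map `s` sees only the one letter of `r` that `ψ` does not kill, and
returns the generator `r`. So `s` is a left inverse of `π` up to the embedding into `WithZero`. -/
theorem injective_of_section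
    (H : ∀ m n, ψ (ψ (m * n)) = ψ (m * n) → ψ (ψ m) = ψ m ∧ ψ (ψ n) = ψ n)
    {b₁ b₂ b₃ b₄ : irreducibles (fixSubmonoid ψ)}
    {π : LengthTwoMonoid b₁ b₂ b₃ b₄ →* LengthTwoMonoid a₁ a₂ a₃ a₄}
    (hπ : ∀ r, π (gen b₁ b₂ b₃ b₄ r) = r)
    {s : LengthTwoMonoid a₁ a₂ a₃ a₄ →* WithZero (LengthTwoMonoid b₁ b₂ b₃ b₄)}
    (hs1 : ∀ x, ψ (gen a₁ a₂ a₃ a₄ x) = 1 → s (gen a₁ a₂ a₃ a₄ x) = 1)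
    (hs : ∀ x (h : ψ (gen a₁ a₂ a₃ a₄ x) ∈ irreducibles (fixSubmonoid ψ)),
      s (gen a₁ a₂ a₃ a₄ x) = gen b₁ b₂ b₃ b₄ ⟨_, h⟩) : Function.Injective π := by
  have hcomp : s.comp π = WithZero.coeMonoidHom := by
    refine hom_ext fun r => ?_
    rw [MonoidHom.comp_apply, hπ]
    refine map_eq_of_map_eq_irreducible H hs1 r.2 (fun x hx => ?_) r.2.1
    rw [hs x (by rw [hx]; exact r.2)]
    have hi : (⟨ψ (gen a₁ a₂ a₃ a₄ x), by rw [hx]; exact r.2⟩ : irreducibles (fixSubmonoid ψ)) = r := Subtype.ext hx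
    rw [hi]; rfl
  intro m n hmn
  have h1 := DFunLike.congr_fun hcomp m
  have h2 := DFunLike.congr_fun hcomp n
  rw [MonoidHom.comp_apply] at h1 h2
  rw [hmn, h2] at h1
  exact (WithZero.coe_inj.1 h1).symm

/-- The fixed points of a retraction form a monoid of the same kind over the irreducibles. -/
theorem exists_presentation_fixSubmonoid
    (H : ∀ m n, ψ (ψ (m * n)) = ψ (m * n) → ψ (ψ m) = ψ m ∧ ψ (ψ n) = ψ n)
    (r₀ : irreducibles (fixSubmonoid ψ)) :
    ∃ (b₁ b₂ b₃ b₄ : irreducibles (fixSubmonoid ψ))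
      (π : LengthTwoMonoid b₁ b₂ b₃ b₄ →* LengthTwoMonoid a₁ a₂ a₃ a₄),
      (∀ r, π (gen b₁ b₂ b₃ b₄ r) = r) ∧ Function.Injective π ∧
      ∀ m ∈ fixSubmonoid ψ, ∃ n, π n = m := by
  have hsurj : ∀ {b₁ b₂ b₃ b₄ : irreducibles (fixSubmonoid ψ)}
      {π : LengthTwoMonoid b₁ b₂ b₃ b₄ →* LengthTwoMonoid a₁ a₂ a₃ a₄},
      (∀ r, π (gen b₁ b₂ b₃ b₄ r) = r) → ∀ m ∈ fixSubmonoid ψ, ∃ n, π n = m := by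
    intro b₁ b₂ b₃ b₄ π hπ m hm
    obtain ⟨g, rfl⟩ := exists_irreducibleProd_eq hm
    exact ⟨word b₁ b₂ b₃ b₄ g, DFunLike.congr_fun
      (FreeMonoid.hom_eq (f := π.comp (word b₁ b₂ b₃ b₄)) (g := irreducibleProd _) fun r => hπ r) g⟩
  by_cases hall : ψ (gen a₁ a₂ a₃ a₄ a₁) ∈ irreducibles (fixSubmonoid ψ) ∧
      ψ (gen a₁ a₂ a₃ a₄ a₂) ∈ irreducibles (fixSubmonoid ψ) ∧
      ψ (gen a₁ a₂ a₃ a₄ a₃) ∈ irreducibles (fixSubmonoid ψ) ∧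
      ψ (gen a₁ a₂ a₃ a₄ a₄) ∈ irreducibles (fixSubmonoid ψ)
  · obtain ⟨h₁, h₂, h₃, h₄⟩ := hall
    let b₁ : irreducibles (fixSubmonoid ψ) := ⟨_, h₁⟩
    let b₂ : irreducibles (fixSubmonoid ψ) := ⟨_, h₂⟩
    let b₃ : irreducibles (fixSubmonoid ψ) := ⟨_, h₃⟩
    let b₄ : irreducibles (fixSubmonoid ψ) := ⟨_, h₄⟩
    let π : LengthTwoMonoid b₁ b₂ b₃ b₄ →* LengthTwoMonoid a₁ a₂ a₃ a₄ :=
      lift Subtype.val (by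
        show ψ _ * ψ _ = ψ _ * ψ _
        rw [← map_mul, gen_rel, map_mul])
    have hπ : ∀ r, π (gen b₁ b₂ b₃ b₄ r) = r := fun r => rfl
    refine ⟨b₁, b₂, b₃, b₄, π, hπ, ?_, hsurj hπ⟩
    let t : FreeMonoid (irreducibles (fixSubmonoid ψ)) →* LengthTwoMonoid b₁ b₂ b₃ b₄ :=
      word b₁ b₂ b₃ b₄
    refine injective_of_section H hπ
      (s := lift (fun x => WithZero.map' t (letterWord ψ x)) ?_) ?_ ?_
    · simp only [letterWord_of_irreducible h₁, letterWord_of_irreducible h₂,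
        letterWord_of_irreducible h₃, letterWord_of_irreducible h₄, WithZero.map'_coe,
        ← WithZero.coe_mul]
      exact congrArg _ gen_rel
    · intro x hx
      rw [lift_gen, letterWord_of_eq_one hx, map_one]
    · intro x hx
      rw [lift_gen, letterWord_of_irreducible hx, WithZero.map'_coe]
      rfl
  · obtain ⟨f, hf, hrel⟩ := exists_extends H hall
    -- The relation `r₀r₀ = r₀r₀` is trivial, so this is the free case.
    let π : LengthTwoMonoid r₀ r₀ r₀ r₀ →* LengthTwoMonoid a₁ a₂ a₃ a₄ :=
      lift Subtype.val rfl
    have hπ : ∀ r, π (gen r₀ r₀ r₀ r₀ r) = r := fun r => rfl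
    refine ⟨r₀, r₀, r₀, r₀, π, hπ, ?_, hsurj hπ⟩
    refine injective_of_section H hπ
      (s := lift (fun x => WithZero.map' (word r₀ r₀ r₀ r₀) (f x)) ?_) ?_ ?_
    · simp only [← map_mul, hrel]
    · intro x hx
      have := letterWord_of_eq_one hx
      rw [lift_gen, hf x (by simp [this]), this, map_one]
    · intro x hx
      have := letterWord_of_irreducible hx
      rw [lift_gen, hf x (by simp [this]), this, WithZero.map'_coe]
      rfl

end Retract

end LengthTwoMonoid

/-! ### Bounded orbits and the retracting power. -/

theorem Function.iterate_add_mul_of_iterate_add_eq {α : Type*} {f : α → α} {x : α} {i p : ℕ}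
    (h : f^[i + p] x = f^[i] x) {k : ℕ} (hk : i ≤ k) (j : ℕ) : f^[k + p * j] x = f^[k] x := by
  have step : ∀ k, i ≤ k → f^[k + p] x = f^[k] x := by
    intro k hk
    obtain ⟨c, rfl⟩ := Nat.exists_eq_add_of_le hk
    rw [show i + c + p = c + (i + p) by ring, Nat.add_comm i c, Function.iterate_add_apply, h,
      ← Function.iterate_add_apply]
  induction j with
  | zero => simp
  | succ j ih => rw [Nat.mul_succ, ← Nat.add_assoc, step _ (by omega), ih]

namespace LengthTwoMonoid

variable {A : Type*} {a₁ a₂ a₃ a₄ : A}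

section Bounded

variable {φ : LengthTwoMonoid a₁ a₂ a₃ a₄ →* LengthTwoMonoid a₁ a₂ a₃ a₄}

/-- The lengths of the iterated images of `m` under `φ` are bounded. -/
def BoundedOrbit (φ : LengthTwoMonoid a₁ a₂ a₃ a₄ →* LengthTwoMonoid a₁ a₂ a₃ a₄)
    (m : LengthTwoMonoid a₁ a₂ a₃ a₄) : Prop :=
  ∃ L, ∀ n, length (φ^[n] m) ≤ L

theorem BoundedOrbit.of_mul {m n : LengthTwoMonoid a₁ a₂ a₃ a₄} (h : BoundedOrbit φ (m * n)) :
    BoundedOrbit φ m ∧ BoundedOrbit φ n := by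
  obtain ⟨L, hL⟩ := h
  have key : ∀ k, length (φ^[k] m) + length (φ^[k] n) ≤ L := fun k => by
    rw [← length_mul, ← iterate_map_mul]; exact hL k
  exact ⟨⟨L, fun k => by have := key k; omega⟩, ⟨L, fun k => by have := key k; omega⟩⟩

theorem boundedOrbit_of_iterate_eq {m : LengthTwoMonoid a₁ a₂ a₃ a₄} {N : ℕ} (hN : 0 < N)
    (h : φ^[N + N] m = φ^[N] m) : BoundedOrbit φ m := by
  refine ⟨∑ k ∈ Finset.range (N + N), length (φ^[k] m), fun n => ?_⟩
  induction n using Nat.strong_induction_on with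
  | _ n ih =>
  by_cases hn : n < N + N
  · exact Finset.single_le_sum (f := fun k => length (φ^[k] m)) (fun _ _ => Nat.zero_le _)
      (Finset.mem_range.2 hn)
  · have := Function.iterate_add_mul_of_iterate_add_eq h (k := n - N) (by omega) 1
    rw [show n - N + N * 1 = n by omega] at this
    rw [this]
    exact ih _ (by omega)

theorem finite_length_le [Finite A] (L : ℕ) :
    {m : LengthTwoMonoid a₁ a₂ a₃ a₄ | length m ≤ L}.Finite := by
  refine ((List.finite_length_le A L).image (fun l => word a₁ a₂ a₃ a₄ (.ofList l))).subset ?_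
  intro m hm
  obtain ⟨w, rfl⟩ := word_surjective m
  refine ⟨w.toList, ?_, rfl⟩
  rw [Set.mem_ofPred_eq, length_word] at hm
  exact hm

theorem BoundedOrbit.exists_iterate_eq [Finite A] {m : LengthTwoMonoid a₁ a₂ a₃ a₄}
    (h : BoundedOrbit φ m) : ∃ N, 0 < N ∧ φ^[N + N] m = φ^[N] m := by
  obtain ⟨L, hL⟩ := h
  obtain ⟨i, j, hij, e⟩ := (finite_length_le L).exists_lt_map_eq_of_forall_mem
    (f := fun n => φ^[n] m) hL
  obtain ⟨p, rfl⟩ := Nat.exists_eq_add_of_le hij.le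
  -- A multiple of the period `p` that is at least the preperiod `i`.
  refine ⟨p * (i + 1), Nat.mul_pos (by omega) (by omega), ?_⟩
  exact Function.iterate_add_mul_of_iterate_add_eq e.symm (by nlinarith) _

/-- Some power of an endomorphism is idempotent on all elements with bounded orbit. -/
theorem exists_iterate_retraction [Finite A]
    (φ : LengthTwoMonoid a₁ a₂ a₃ a₄ →* LengthTwoMonoid a₁ a₂ a₃ a₄) :
    ∃ N, 0 < N ∧ ∃ ψ : LengthTwoMonoid a₁ a₂ a₃ a₄ →* LengthTwoMonoid a₁ a₂ a₃ a₄,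
      (∀ m, ψ m = φ^[N] m) ∧
      ∀ m n, ψ (ψ (m * n)) = ψ (m * n) → ψ (ψ m) = ψ m ∧ ψ (ψ n) = ψ n := by
  have := Fintype.ofFinite A
  have hex : ∀ x : A, ∃ N, 0 < N ∧ (BoundedOrbit φ (gen a₁ a₂ a₃ a₄ x) →
      φ^[N + N] (gen a₁ a₂ a₃ a₄ x) = φ^[N] (gen a₁ a₂ a₃ a₄ x)) := by
    intro x
    by_cases hx : BoundedOrbit φ (gen a₁ a₂ a₃ a₄ x)
    · obtain ⟨N, hN, e⟩ := hx.exists_iterate_eq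
      exact ⟨N, hN, fun _ => e⟩
    · exact ⟨1, one_pos, fun h => absurd h hx⟩
  choose c hc0 hc using hex
  -- Each `c x` may be replaced by any positive multiple, so the product serves all letters at once.
  have hN : 0 < ∏ x, c x := Finset.prod_pos fun x _ => hc0 x
  set N := ∏ x, c x
  obtain ⟨ψ, hψ⟩ : ∃ ψ : LengthTwoMonoid a₁ a₂ a₃ a₄ →* LengthTwoMonoid a₁ a₂ a₃ a₄,
      ∀ m, ψ m = φ^[N] m :=
    ⟨(show Monoid.End (LengthTwoMonoid a₁ a₂ a₃ a₄) from φ) ^ N,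
      fun m => congrFun (Monoid.End.coe_pow (M := LengthTwoMonoid a₁ a₂ a₃ a₄) φ N) m⟩
  have hψψ : ∀ m, ψ (ψ m) = φ^[N + N] m := fun m => by
    rw [hψ, hψ, Function.iterate_add_apply]
  have hgood : ∀ m, BoundedOrbit φ m → ψ (ψ m) = ψ m := by
    intro m
    induction m using induction_left with
    | one => intro _; rw [map_one]; exact map_one ψ
    | mul x m ih =>
      intro hm
      obtain ⟨hx, hm⟩ := hm.of_mul
      have hx' : ψ (ψ (gen a₁ a₂ a₃ a₄ x)) = ψ (gen a₁ a₂ a₃ a₄ x) := by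
        rw [hψψ, hψ]
        obtain ⟨d, hd⟩ : c x ∣ N := Finset.dvd_prod_of_mem c (Finset.mem_univ x)
        have := Function.iterate_add_mul_of_iterate_add_eq (hc x hx) (Nat.le_of_dvd hN ⟨d, hd⟩) d
        rwa [← hd] at this
      rw [map_mul, map_mul, hx', ih hm]
  refine ⟨N, hN, ψ, hψ, fun m n h => ?_⟩
  rw [hψψ, hψ] at h
  obtain ⟨h1, h2⟩ := (boundedOrbit_of_iterate_eq hN h).of_mul
  exact ⟨hgood m h1, hgood n h2⟩

/-- On `Fix ψ` the map `φ` is an automorphism with inverse `φ^[k]`, so it preserves irreducibility.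
-/
theorem map_mem_irreducibles {ψ : LengthTwoMonoid a₁ a₂ a₃ a₄ →* LengthTwoMonoid a₁ a₂ a₃ a₄}
    {k : ℕ} (hψ : ∀ m, ψ m = φ^[k + 1] m) {r : LengthTwoMonoid a₁ a₂ a₃ a₄}
    (hr : r ∈ irreducibles (fixSubmonoid ψ)) : φ r ∈ irreducibles (fixSubmonoid ψ) := by
  have hfix : ∀ {m}, m ∈ fixSubmonoid ψ ↔ φ^[k + 1] m = m := fun {m} => by
    rw [← hψ]; rfl
  have hback : ∀ {m}, m ∈ fixSubmonoid ψ → φ^[k] (φ m) = m := fun h => hfix.1 h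
  have hone : ∀ {m}, m ∈ fixSubmonoid ψ → φ^[k] m = 1 → m = 1 := fun {m} h e => by
    rw [← hfix.1 h, Function.iterate_succ_apply', e, map_one]
  have hmem : ∀ {m}, m ∈ fixSubmonoid ψ → φ^[k] m ∈ fixSubmonoid ψ := fun {m} h => by
    rw [hfix, ← Function.iterate_add_apply, Nat.add_comm, Function.iterate_add_apply, hfix.1 h]
  refine ⟨?_, fun h => hr.2.1 ?_, fun s hs t ht e => ?_⟩
  · rw [hfix, ← Function.iterate_succ_apply, Function.iterate_succ_apply', hfix.1 hr.1]
  · rw [← hback hr.1, h, iterate_map_one]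
  · have := hr.2.2 _ (hmem hs) _ (hmem ht) (by rw [← iterate_map_mul, ← e, hback hr.1])
    exact this.imp (hone hs) (hone ht)

end Bounded

/-! ### The bound for arbitrary endomorphisms. -/

/-- The submonoid of fixed points of an endomorphism of `⟨A | a₁a₂ = a₃a₄⟩` is generated by at most
`|A|` elements. -/
theorem exists_closure_eq_fixSubmonoid [Finite A]
    (φ : LengthTwoMonoid a₁ a₂ a₃ a₄ →* LengthTwoMonoid a₁ a₂ a₃ a₄) :
    ∃ B : Set (LengthTwoMonoid a₁ a₂ a₃ a₄),
      Submonoid.closure B = fixSubmonoid φ ∧ B.encard ≤ ENat.card A := by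
  obtain ⟨N, hN, ψ, hψ, H⟩ := exists_iterate_retraction φ
  obtain ⟨k, rfl⟩ := Nat.exists_eq_succ_of_ne_zero hN.ne'
  have hsub : ∀ m, φ m = m → m ∈ fixSubmonoid ψ := fun m hm =>
    (hψ m).trans (Function.iterate_fixed hm _)
  rcases isEmpty_or_nonempty (irreducibles (fixSubmonoid ψ)) with hI | ⟨⟨r₀⟩⟩
  · refine ⟨∅, ?_, by simp⟩
    rw [Submonoid.closure_empty]
    refine le_antisymm bot_le fun m hm => ?_
    obtain ⟨g, rfl⟩ := exists_irreducibleProd_eq (hsub m hm)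
    induction g using FreeMonoid.casesOn with
    | one => simp
    | of_mul r _ => exact hI.elim r
  obtain ⟨b₁, b₂, b₃, b₄, π, hπ, hinj, hsurj⟩ := exists_presentation_fixSubmonoid H r₀
  let σ : irreducibles (fixSubmonoid ψ) → irreducibles (fixSubmonoid ψ) :=
    fun r => ⟨φ r, map_mem_irreducibles hψ r.2⟩
  have hσ : Function.Injective σ := by
    intro r r' h
    have h' : φ r = φ r' := congrArg Subtype.val h
    have hr : ψ r = r := r.2.1
    have hr' : ψ r' = r' := r'.2.1
    exact Subtype.ext (by
      rw [← hr, ← hr', hψ, hψ, Function.iterate_succ_apply, h', ← Function.iterate_succ_apply])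
  have hπσ : ∀ r, π (gen b₁ b₂ b₃ b₄ (σ r)) = φ (π (gen b₁ b₂ b₃ b₄ r)) := fun r => by
    rw [hπ, hπ]
  -- This is `φ` restricted to `Fix ψ`, read in the presentation; injectivity of `π` shows that it
  -- respects the relation.
  let Φ : LengthTwoMonoid b₁ b₂ b₃ b₄ →* LengthTwoMonoid b₁ b₂ b₃ b₄ :=
    lift (fun r => gen b₁ b₂ b₃ b₄ (σ r)) (hinj (by
      rw [map_mul, map_mul, hπσ, hπσ, hπσ, hπσ, ← map_mul, ← map_mul, ← map_mul, ← map_mul,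
        gen_rel]))
  have hcomm : ∀ m, π (Φ m) = φ (π m) := DFunLike.congr_fun
    (hom_ext (f := π.comp Φ) (g := φ.comp π) fun r => hπσ r)
  obtain ⟨B, hB, hcard⟩ := exists_closure_eq_fixSubmonoid_of_perm hσ (Φ := Φ) fun r => rfl
  refine ⟨π '' B, ?_, (Set.encard_image_le _ _).trans (hcard.trans ?_)⟩
  · rw [← MonoidHom.map_mclosure, hB]
    ext m
    constructor
    · rintro ⟨n, hn, rfl⟩
      exact (hcomm n).symm.trans (congrArg π hn)
    · intro hm
      obtain ⟨n, rfl⟩ := hsurj m (hsub m hm)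
      exact ⟨n, hinj ((hcomm n).trans hm), rfl⟩
  -- Distinct irreducibles are images of distinct letters, so there are at most `|A|` of them.
  · choose y hy using fun r : irreducibles (fixSubmonoid ψ) => exists_gen_of_irreducible H r.2
    exact ENat.card_le_card_of_injective (f := y) fun r r' h =>
      Subtype.ext (by rw [← hy r, ← hy r', h])

end LengthTwoMonoid

/-! ### From generating sets to ranks. -/

theorem Set.encard_preimage_val_le {α : Type*} (p : α → Prop) (B : Set α) :
    ((Subtype.val : Subtype p → α) ⁻¹' B).encard ≤ B.encard := by
  rw [← Subtype.val_injective.encard_image]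
  exact Set.encard_le_encard (Set.image_preimage_subset _ _)

theorem monoidRank_le {M : Type*} [Monoid M] {B : Set M} (hne : B.Nonempty)
    (h : Submonoid.closure B = ⊤) : monoidRank M ≤ B.encard :=
  sInf_le ⟨B, hne, h, rfl⟩

theorem semigroupRank_le {S : Type*} [Semigroup S] {B : Set S}
    (h : Subsemigroup.closure B = ⊤) : semigroupRank S ≤ B.encard :=
  sInf_le ⟨B, h, rfl⟩

theorem monoidRank_le_of_closure_eq {M : Type*} [Monoid M] {P : Submonoid M} {B : Set M}
    (hB : Submonoid.closure B = P) {n : ℕ∞} (hn : 1 ≤ n) (hcard : B.encard ≤ n) :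
    monoidRank P ≤ n := by
  subst hB
  have hgen := Submonoid.closure_closure_coe_preimage (s := B)
  by_cases hne : (((↑) : Submonoid.closure B → M) ⁻¹' B).Nonempty
  · exact (monoidRank_le hne hgen).trans ((Set.encard_preimage_val_le _ _).trans hcard)
  -- An empty generating set is not admissible for the monoid rank; `{1}` replaces it, at the cost
  -- of `1 ≤ n`.
  · refine (monoidRank_le (Set.singleton_nonempty 1) ?_).trans ((Set.encard_singleton _).trans_le hn)
    rw [Set.not_nonempty_iff_eq_empty.1 hne] at hgen
    exact top_unique (hgen ▸ Submonoid.closure_mono (Set.empty_subset _))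

/-- The extra generator is the identity, which products of elements of `B` need not produce. -/
theorem semigroupRank_le_of_closure_eq {M : Type*} [Monoid M] {P : Submonoid M} {B : Set M}
    (hB : Submonoid.closure B = P) {n : ℕ∞} (hcard : B.encard ≤ n) :
    semigroupRank P ≤ n + 1 := by
  subst hB
  have hgen := Submonoid.closure_closure_coe_preimage (s := B)
  refine (semigroupRank_le (B := insert 1 (((↑) : Submonoid.closure B → M) ⁻¹' B)) ?_).trans
    ((Set.encard_insert_le _ _).trans
      (add_le_add_left ((Set.encard_preimage_val_le _ _).trans hcard) 1))
  refine top_unique fun m _ => ?_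
  have hm : m ∈ Submonoid.closure (((↑) : Submonoid.closure B → M) ⁻¹' B) := hgen ▸ trivial
  induction hm using Submonoid.closure_induction with
  | mem x hx => exact Subsemigroup.subset_closure (.inr hx)
  | one => exact Subsemigroup.subset_closure (.inl rfl)
  | mul x y _ _ hx hy => exact mul_mem (hx trivial) (hy trivial)

/-! ### Transfer to the semigroup. -/

namespace LengthTwoSemigroup

open LengthTwoMonoid

variable {A : Type*} {a₁ a₂ a₃ a₄ : A}

/-- The image of a letter in the semigroup `⟨A | a₁a₂ = a₃a₄⟩`. -/
def letter (a₁ a₂ a₃ a₄ : A) (x : A) : LengthTwoSemigroup a₁ a₂ a₃ a₄ :=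
  ((FreeSemigroup.of x : FreeSemigroup A) : (conGen _).Quotient)

theorem letter_rel : letter a₁ a₂ a₃ a₄ a₁ * letter a₁ a₂ a₃ a₄ a₂ =
    letter a₁ a₂ a₃ a₄ a₃ * letter a₁ a₂ a₃ a₄ a₄ :=
  (Con.eq _).2 (.of _ _ ⟨rfl, rfl⟩)

@[elab_as_elim]
theorem induction {p : LengthTwoSemigroup a₁ a₂ a₃ a₄ → Prop} (s : LengthTwoSemigroup a₁ a₂ a₃ a₄)
    (letter : ∀ x, p (letter a₁ a₂ a₃ a₄ x))
    (mul : ∀ x s, p s → p (LengthTwoSemigroup.letter a₁ a₂ a₃ a₄ x * s)) : p s := by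
  induction s using Con.induction_on with
  | _ w =>
  induction w using FreeSemigroup.recOnMul with
  | ih1 x => exact letter x
  | ih2 x w _ ih => exact mul x _ ih

/-- The embedding of the semigroup into the monoid with the same presentation. -/
def toMonoid (a₁ a₂ a₃ a₄ : A) :
    LengthTwoSemigroup a₁ a₂ a₃ a₄ →ₙ* LengthTwoMonoid a₁ a₂ a₃ a₄ where
  toFun s := Con.liftOn s (FreeSemigroup.lift (gen a₁ a₂ a₃ a₄)) (by
    intro v w h
    refine Con.conGen_le (c := Con.ker (FreeSemigroup.lift (gen a₁ a₂ a₃ a₄))).2 ?_ h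
    rintro _ _ ⟨rfl, rfl⟩
    exact gen_rel)
  map_mul' s t := by
    induction s using Con.induction_on
    induction t using Con.induction_on
    exact map_mul (FreeSemigroup.lift (gen a₁ a₂ a₃ a₄)) _ _

@[simp]
theorem toMonoid_letter (x : A) :
    toMonoid a₁ a₂ a₃ a₄ (letter a₁ a₂ a₃ a₄ x) = gen a₁ a₂ a₃ a₄ x := rfl

/-- The semigroup with an identity adjoined satisfies the same relation, which provides a map back.
-/
theorem toMonoid_injective : Function.Injective (toMonoid a₁ a₂ a₃ a₄) := by
  let f : LengthTwoMonoid a₁ a₂ a₃ a₄ →* WithOne (LengthTwoSemigroup a₁ a₂ a₃ a₄) :=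
    lift (fun x => (letter a₁ a₂ a₃ a₄ x : WithOne _)) (by
      rw [← WithOne.coe_mul, letter_rel, WithOne.coe_mul])
  have hf : ∀ s, f (toMonoid a₁ a₂ a₃ a₄ s) = s := by
    intro s
    induction s using induction with
    | letter x => rfl
    | mul x s ih => rw [map_mul, map_mul, ih, WithOne.coe_mul]; rfl
  intro s t h
  exact WithOne.coe_injective ((hf s).symm.trans ((congrArg f h).trans (hf t)))

theorem eq_one_or_exists_toMonoid (m : LengthTwoMonoid a₁ a₂ a₃ a₄) :
    m = 1 ∨ ∃ s, toMonoid a₁ a₂ a₃ a₄ s = m := by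
  induction m using induction_left with
  | one => exact .inl rfl
  | mul x m ih =>
    rcases ih with rfl | ⟨s, rfl⟩
    · exact .inr ⟨letter a₁ a₂ a₃ a₄ x, by simp⟩
    · exact .inr ⟨letter a₁ a₂ a₃ a₄ x * s, by simp⟩

theorem toMonoid_ne_one (s : LengthTwoSemigroup a₁ a₂ a₃ a₄) : toMonoid a₁ a₂ a₃ a₄ s ≠ 1 := by
  intro h
  have := congrArg length h
  induction s using induction with
  | letter x => simp at this
  | mul x s _ => simp at this

theorem semigroupRank_fixSubsemigroup_le [Finite A]
    (φ : LengthTwoSemigroup a₁ a₂ a₃ a₄ →ₙ* LengthTwoSemigroup a₁ a₂ a₃ a₄) :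
    semigroupRank (fixSubsemigroup φ) ≤ ENat.card A := by
  let φ' : LengthTwoMonoid a₁ a₂ a₃ a₄ →* LengthTwoMonoid a₁ a₂ a₃ a₄ :=
    lift (fun x => toMonoid a₁ a₂ a₃ a₄ (φ (letter a₁ a₂ a₃ a₄ x))) (by
      rw [← map_mul, ← map_mul, ← map_mul, ← map_mul, letter_rel])
  have hφ' : ∀ s, φ' (toMonoid a₁ a₂ a₃ a₄ s) = toMonoid a₁ a₂ a₃ a₄ (φ s) := by
    intro s
    induction s using induction with
    | letter x => rfl
    | mul x s ih => rw [map_mul, map_mul, ih, map_mul, map_mul]; rfl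
  have hfix : ∀ s, s ∈ fixSubsemigroup φ ↔ toMonoid a₁ a₂ a₃ a₄ s ∈ fixSubmonoid φ' := fun s =>
    ⟨fun h => (hφ' s).trans (congrArg _ h), fun h => toMonoid_injective ((hφ' s).symm.trans h)⟩
  obtain ⟨B, hB, hcard⟩ := exists_closure_eq_fixSubmonoid φ'
  -- At most the element `1` of `B` is lost here, and it contributes nothing to nontrivial products.
  let C : Set (LengthTwoSemigroup a₁ a₂ a₃ a₄) := toMonoid a₁ a₂ a₃ a₄ ⁻¹' B
  have hC : Subsemigroup.closure C = fixSubsemigroup φ := by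
    apply le_antisymm
    · rw [Subsemigroup.closure_le]
      intro s hs
      exact (hfix s).2 (hB ▸ Submonoid.subset_closure hs)
    · have key : ∀ m ∈ Submonoid.closure B,
          m = 1 ∨ ∃ s ∈ Subsemigroup.closure C, toMonoid a₁ a₂ a₃ a₄ s = m := by
        intro m hm
        induction hm using Submonoid.closure_induction with
        | mem m hm =>
          rcases eq_one_or_exists_toMonoid m with h | ⟨s, rfl⟩
          · exact .inl h
          · exact .inr ⟨s, Subsemigroup.subset_closure hm, rfl⟩
        | one => exact .inl rfl
        | mul m n _ _ hm hn =>
          rcases hm with rfl | ⟨s, hs, rfl⟩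
          · rwa [one_mul]
          · rcases hn with rfl | ⟨t, ht, rfl⟩
            · rw [mul_one]; exact .inr ⟨s, hs, rfl⟩
            · exact .inr ⟨s * t, mul_mem hs ht, map_mul _ _ _⟩
      intro s hs
      obtain ⟨t, ht, e⟩ := (key _ (hB ▸ (hfix s).1 hs)).resolve_left (toMonoid_ne_one s)
      exact toMonoid_injective e ▸ ht
  have hCcard : C.encard ≤ ENat.card A := by
    rw [← toMonoid_injective.encard_image]
    exact (Set.encard_le_encard (Set.image_preimage_subset _ _)).trans hcard
  rw [← hC]
  exact (semigroupRank_le Subsemigroup.closure_closure_coe_preimage).trans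
    ((Set.encard_preimage_val_le _ _).trans hCcard)

end LengthTwoSemigroup

theorem mainTheorem5 {A : Type*} [Finite A] (a₁ a₂ a₃ a₄ : A) :
    (∀ φ : LengthTwoMonoid a₁ a₂ a₃ a₄ →* LengthTwoMonoid a₁ a₂ a₃ a₄,
      monoidRank (fixSubmonoid φ) ≤ (Nat.card A : ℕ∞)) ∧
    InUEMonoid (LengthTwoMonoid a₁ a₂ a₃ a₄) ∧
    InUESemigroup (LengthTwoSemigroup a₁ a₂ a₃ a₄) := by
  have hcardA : ENat.card A = (Nat.card A : ℕ∞) := ENat.card_eq_coe_natCard A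
  refine ⟨fun φ => ?_, ⟨Nat.card A + 1, fun φ => ?_⟩, ⟨Nat.card A, fun φ => ?_⟩⟩
  · obtain ⟨B, hB, hcard⟩ := LengthTwoMonoid.exists_closure_eq_fixSubmonoid φ
    have : Nonempty A := ⟨a₁⟩
    exact monoidRank_le_of_closure_eq hB (by exact_mod_cast Nat.card_pos) (hcardA ▸ hcard)
  · obtain ⟨B, hB, hcard⟩ := LengthTwoMonoid.exists_closure_eq_fixSubmonoid φ
    push_cast
    exact semigroupRank_le_of_closure_eq hB (hcardA ▸ hcard)
  · exact hcardA ▸ LengthTwoSemigroup.semigroupRank_fixSubsemigroup_le φ
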